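/- Let $f:\mathbb R^2\to\mathbb R$ be a smooth function and let $$g=2(dx_1\,dx_3+dx_2\,dx_4)+f(x_1,x_2)\,(dx_1^2+dx_2^2)$$ be the corresponding Petean metric on $\mathbb R^4$, a metric of signature $(2,2)$; orient $\mathbb R^4$ by $(\partial_1,\partial_2,\partial_3,\partial_4)$. A $\beta$-plane at a point is a totally null tangent 2-plane whose bivector is anti-self-dual, and a $\beta$-surface is a connected smoothly embedded surface in $\mathbb R^4$ whose tangent plane is a $\beta$-plane at every point and which is maximal with respect to inclusion among such surfaces. Then for every $\beta$-surface $S$ of $(\mathbb R^4,g)$ there are real constants $\sigma,c_1,c_2$ such that $S$ is the set of all solutions $(x_1,x_2,x_3,x_4)\in\mathbb R^4$ of $$\begin{cases}-\sin\sigma\;x_1+\cos\sigma\;x_2=c_1,\\ \cos\sigma\;x_3+\sin\sigma\;x_4+\varphi(x_1,x_2,\sigma)=c_2,\end{cases}$$ where $$\varphi(x_1,x_2,\sigma)=\frac12\int_0^{\lambda} f(\cos\sigma\,t-\sin\sigma\,\mu,\ \sin\sigma\,t+\cos\sigma\,\mu)\,dt,$$ with $\lambda=\cos\sigma\,x_1+\sin\sigma\,x_2$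 and $\mu=-\sin\sigma\,x_1+\cos\sigma\,x_2$. -/

import Mathlib

open scoped ContDiff Topology

namespace Petean

/-- The space `ℝ⁴`; the coordinates `x₁, x₂, x₃, x₄` of a point `x` are `x 0, x 1, x 2, x 3`. -/
abbrev R4 : Type := Fin 4 → ℝ

/-- Petean's metric `g = 2 (dx₁ dx₃ + dx₂ dx₄) + f(x₁, x₂) (dx₁² + dx₂²)` on `ℝ⁴`, given by its
Gram matrix `(g(∂ᵢ, ∂ⱼ))` at each point. -/
def metric (f : ℝ × ℝ → ℝ) (x : R4) : Matrix (Fin 4) (Fin 4) ℝ :=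
  !![f (x 0, x 1), 0, 1, 0;
     0, f (x 0, x 1), 0, 1;
     1, 0, 0, 0;
     0, 1, 0, 0]

/-- The components `vⁱ wʲ - vʲ wⁱ` of the bivector `v ∧ w`. -/
def wedge (v w : R4) : Matrix (Fin 4) (Fin 4) ℝ :=
  Matrix.of fun i j => v i * w j - v j * w i

/-- The Levi-Civita symbol: the sign of `(i, j, k, l)` if it is a permutation of the four
indices, and `0` otherwise. -/
def leviCivita (i j k l : Fin 4) : ℤ :=
  Matrix.det (Matrix.of fun a b : Fin 4 => if ![i, j, k, l] a = b then (1 : ℤ) else 0)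

/-- The Hodge star on bivectors of `ℝ⁴` for the scalar product with Gram matrix `G` and the
standard orientation `(∂₁, ∂₂, ∂₃, ∂₄)`:
`(⋆B)ⁱʲ = (1 / 2) |det G|^(-1/2) ∑ εⁱʲᵏˡ G_{km} G_{ln} Bᵐⁿ`. -/
noncomputable def hodgeStar (G B : Matrix (Fin 4) (Fin 4) ℝ) : Matrix (Fin 4) (Fin 4) ℝ :=
  Matrix.of fun i j =>
    (1 / 2) * (Real.sqrt |G.det|)⁻¹ *
      ∑ k, ∑ l, (leviCivita i j k l : ℝ) * (G * B * G.transpose) k l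

/-- A `β`-plane of the scalar product with Gram matrix `G`: a totally null 2-plane whose
bivector is anti-self-dual. -/
def IsBetaPlane (G : Matrix (Fin 4) (Fin 4) ℝ) (P : Submodule ℝ R4) : Prop :=
  Module.finrank ℝ P = 2 ∧
  (∀ v ∈ P, ∀ w ∈ P, v ⬝ᵥ G.mulVec w = 0) ∧
  (∀ v ∈ P, ∀ w ∈ P, hodgeStar G (wedge v w) = -wedge v w)

/-- `S` is a smooth embedded surface (2-dimensional submanifold) in `ℝ⁴`: around each of its
points it has a smooth regular parametrization that is a homeomorphism onto a relatively open
subset of `S`. -/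
def IsEmbeddedSurface (S : Set R4) : Prop :=
  ∀ p ∈ S, ∃ (U : Set R4) (V : Set (Fin 2 → ℝ)) (ψ : (Fin 2 → ℝ) → R4),
    IsOpen U ∧ p ∈ U ∧ IsOpen V ∧ ContDiffOn ℝ ∞ ψ V ∧
    (∀ u ∈ V, Function.Injective (fderiv ℝ ψ u)) ∧
    Topology.IsEmbedding (V.domRestrict ψ) ∧ ψ '' V = S ∩ U

/-- The tangent space of `S` at `p`, spanned by the velocities at `p` of the smooth curves
in `S` through `p`. -/
def tangentPlane (S : Set R4) (p : R4) : Submodule ℝ R4 :=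
  Submodule.span ℝ {v | ∃ γ : ℝ → R4, ContDiffAt ℝ ∞ γ 0 ∧ γ 0 = p ∧
    (∀ᶠ t in 𝓝 (0 : ℝ), γ t ∈ S) ∧ deriv γ 0 = v}

/-- A `β`-surface of the metric with Gram matrices `g`: a connected embedded surface whose
tangent plane is a `β`-plane at every point, and which is maximal (for inclusion) among these. -/
def IsBetaSurface (g : R4 → Matrix (Fin 4) (Fin 4) ℝ) (S : Set R4) : Prop :=
  Maximal (fun T : Set R4 => IsConnected T ∧ IsEmbeddedSurface T ∧
    ∀ p ∈ T, IsBetaPlane (g p) (tangentPlane T p)) S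

/-- `φ(x₁, x₂, σ) = (1/2) ∫₀^l f(cos σ t - sin σ m, sin σ t + cos σ m) dt` with
`l = cos σ x₁ + sin σ x₂` and `m = -sin σ x₁ + cos σ x₂`. -/
noncomputable def phi (f : ℝ × ℝ → ℝ) (x₁ x₂ σ : ℝ) : ℝ :=
  (1 / 2) * ∫ t in (0 : ℝ)..(Real.cos σ * x₁ + Real.sin σ * x₂),
    f (Real.cos σ * t - Real.sin σ * (-Real.sin σ * x₁ + Real.cos σ * x₂),
       Real.sin σ * t + Real.cos σ * (-Real.sin σ * x₁ + Real.cos σ * x₂))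

end Petean

namespace Petean

/-! A `β`-plane projects onto a line of the `(x₁, x₂)`-plane. If `(l, m)` spans that line, the plane
is cut out by `-m dx₁ + l dx₂` and `(f/2)(l dx₁ + m dx₂) + l dx₃ + m dx₄` (`IsBetaPlane.relations`).
On a surface tangent to `β`-planes both forms vanish, hence so do their exterior derivatives. With
`ρ = l dm - m dl` this gives `ρ ∧ θ = ρ ∧ η = 0` for a coframe `θ, η` of the surface, so `ρ = 0` and
the angle `σ` of `(l, m)` is locally constant (`direction_fderiv_eq_zero`).

For constant `σ` the first form is exact, and the second one is exact along the line `μ = const`,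
where `φ` is a primitive of `(f/2) dλ`. Thus both left-hand sides of the system are locally constant
(`local_constancy`), and connectedness makes them constant (`exists_subset_modelSurface`). The full
solution set is itself a connected embedded surface with `β`-tangent planes (`modelSurface_isBeta`),
so maximality gives equality. -/

/-! ### Linear algebra of `β`-planes. -/

/-- The Vandermonde product vanishes on repeated indices and is alternating; at `(0, 1, 2, 3)` it is
`1·2·3·1·2·1 = 12`. -/
theorem leviCivita_mul_twelve (i j k l : Fin 4) : leviCivita i j k l * 12 =
    ((j : ℤ) - i) * (k - i) * (l - i) * (k - j) * (l - j) * (l - k) := by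
  simp only [leviCivita]
  simp [Matrix.det_succ_row_zero, Fin.sum_univ_succ, Fin.succAbove]
  revert i j k l
  decide +kernel

theorem leviCivita_cast (i j k l : Fin 4) : (leviCivita i j k l : ℝ) =
    ((j.val : ℝ) - i.val) * (k.val - i.val) * (l.val - i.val) * (k.val - j.val) * (l.val - j.val) * (l.val - k.val) / 12 := by
  rw [eq_div_iff (by norm_num)]
  exact_mod_cast leviCivita_mul_twelve i j k l

theorem det_metric (f : ℝ × ℝ → ℝ) (x : R4) : (metric f x).det = 1 := by
  simp [metric, Matrix.det_succ_row_zero, Fin.sum_univ_succ, Fin.succAbove]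

/-- Anti-self-duality of `v ∧ w` in terms of its components. -/
theorem hodgeStar_wedge (f : ℝ × ℝ → ℝ) (x v w : R4) :
    hodgeStar (metric f x) (wedge v w) = -wedge v w ↔
      v 0 * w 1 - v 1 * w 0 = 0 ∧
      (v 0 * w 2 - v 2 * w 0) + (v 1 * w 3 - v 3 * w 1) = 0 ∧
      2 * (v 2 * w 3 - v 3 * w 2) +
        f (x 0, x 1) * ((v 0 * w 3 - v 3 * w 0) - (v 1 * w 2 - v 2 * w 1)) = 0 := by
  have key : ∀ i j, hodgeStar (metric f x) (wedge v w) i j = (1 / 2) *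
      ∑ k, ∑ l, (leviCivita i j k l : ℝ) *
       (metric f x * wedge v w * (metric f x).transpose) k l := by
    intro i j; simp [hodgeStar, det_metric]
  have low : metric f x * wedge v w * (metric f x).transpose =
    Matrix.of fun i j => (metric f x).mulVec v i * (metric f x).mulVec w j -
      (metric f x).mulVec v j * (metric f x).mulVec w i := by
    ext i j
    simp only [Matrix.mul_apply, wedge, Matrix.of_apply, Matrix.transpose_apply, Matrix.mulVec, dotProduct, Fin.sum_univ_four]
    ring
  have low' : (metric f x).mulVec v = ![f (x 0, x 1) * v 0 + v 2, f (x 0, x 1) * v 1 + v 3, v 0, v 1] := by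
    ext i; fin_cases i <;> simp [metric, Matrix.mulVec, dotProduct, Fin.sum_univ_four]
  have low'' : (metric f x).mulVec w = ![f (x 0, x 1) * w 0 + w 2, f (x 0, x 1) * w 1 + w 3, w 0, w 1] := by
    ext i; fin_cases i <;> simp [metric, Matrix.mulVec, dotProduct, Fin.sum_univ_four]
  rw [low, low', low''] at key
  generalize f (x 0, x 1) = c at *
  simp only [leviCivita_cast, Fin.sum_univ_four, Matrix.of_apply] at key
  constructor
  · intro h
    have h01 := congrFun (congrFun h 0) 1
    have h02 := congrFun (congrFun h 0) 2
    have h23 := congrFun (congrFun h 2) 3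
    rw [key] at h01 h02 h23
    simp [wedge] at h01 h02 h23
    refine ⟨by linarith, by linarith, ?_⟩
    have : v 0 * w 1 - v 1 * w 0 = 0 := by linarith
    linear_combination h23 - c ^ 2 * this
  · rintro ⟨h1, h2, h3⟩
    ext i j
    rw [key]
    clear key low low' low''
    fin_cases i <;> fin_cases j <;> simp [wedge] <;> first
      | ring1
      | linear_combination 2 * h1
      | linear_combination h2
      | linear_combination (- 2) * h1
      | linear_combination -h2
      | linear_combination c * h1
      | linear_combination -c * h1
      | linear_combination h3 + c^2 * h1
      | linear_combination -h3 - c^2 * h1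

theorem dotProduct_metric_mulVec (f : ℝ × ℝ → ℝ) (x v w : R4) :
    v ⬝ᵥ (metric f x).mulVec w = v 0 * w 2 + v 1 * w 3 + v 2 * w 0 + v 3 * w 1 +
      f (x 0, x 1) * (v 0 * w 0 + v 1 * w 1) := by
  simp [metric, Matrix.mulVec, dotProduct, Fin.sum_univ_four]
  ring

/-- A `β`-plane contains a vector with nonzero projection to the `(x₁, x₂)`-plane. -/
theorem IsBetaPlane.exists_ne_zero {f : ℝ × ℝ → ℝ} {x : R4} {P : Submodule ℝ R4}
    (hP : IsBetaPlane (metric f x) P) : ∃ e ∈ P, e 0 ^ 2 + e 1 ^ 2 ≠ 0 := by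
  obtain ⟨hdim, -, hasd⟩ := hP
  by_contra! hcon
  have h0 : ∀ v ∈ P, v 0 = 0 ∧ v 1 = 0 := fun v hv =>
    ⟨by nlinarith [hcon v hv, sq_nonneg (v 0), sq_nonneg (v 1)],
     by nlinarith [hcon v hv, sq_nonneg (v 0), sq_nonneg (v 1)]⟩
  -- `∂₃ ∧ ∂₄` is self-dual, so vectors of `P` lying in the span of `∂₃, ∂₄` are pairwise
  -- proportional, which forces dimension at most one.
  have h1 : ∀ v ∈ P, ∀ w ∈ P, v 2 * w 3 - v 3 * w 2 = 0 := by
    intro v hv w hw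
    have := ((hodgeStar_wedge f x v w).1 (hasd v hv w hw)).2.2
    obtain ⟨a, b⟩ := h0 v hv
    obtain ⟨c, d⟩ := h0 w hw
    rw [a, b, c, d] at this
    linarith
  have hle : ∃ u : R4, P ≤ Submodule.span ℝ {u} := by
    by_cases hne : ∃ u ∈ P, u ≠ 0
    · obtain ⟨u, hu, hu0⟩ := hne
      obtain ⟨a, b⟩ := h0 u hu
      refine ⟨u, fun w hw => ?_⟩
      obtain ⟨c, d⟩ := h0 w hw
      have hw1 := h1 u hu w hw
      rw [Submodule.mem_span_singleton]
      by_cases h2 : u 2 = 0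
      · have h3 : u 3 ≠ 0 := by
          intro h3
          apply hu0
          ext i
          fin_cases i <;> simpa
        rw [h2] at hw1
        have : w 2 = 0 := by
          have : u 3 * w 2 = 0 := by linarith
          simpa [h3] using this
        refine ⟨w 3 / u 3, ?_⟩
        ext i
        fin_cases i <;> simp [*]
      · refine ⟨w 2 / u 2, ?_⟩
        ext i
        fin_cases i <;> simp [*]
        field_simp
        linarith
    · push Not at hne
      exact ⟨0, fun w hw => by rw [hne w hw]; exact zero_mem _⟩
  obtain ⟨u, hu⟩ := hle
  have h2 := Submodule.finrank_mono hu
  have h3 := finrank_span_le_card (R := ℝ) ({u} : Set R4)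
  simp at h3
  omega

/-- Anti-self-duality makes the projections of `e` and `v` parallel; then `g(e, e) = 0` eliminates
`e 2`, `e 3` from `g(e, v) = 0`, turning the coefficient `f` into `f / 2`. -/
theorem IsBetaPlane.relations {f : ℝ × ℝ → ℝ} {x : R4} {P : Submodule ℝ R4}
    (hP : IsBetaPlane (metric f x) P) {e v : R4} (he : e ∈ P) (hv : v ∈ P)
    (h0 : e 0 ^ 2 + e 1 ^ 2 ≠ 0) :
    -e 1 * v 0 + e 0 * v 1 = 0 ∧
    f (x 0, x 1) / 2 * (e 0 * v 0 + e 1 * v 1) + e 0 * v 2 + e 1 * v 3 = 0 := by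
  obtain ⟨-, hnull, hasd⟩ := hP
  have h1 := ((hodgeStar_wedge f x e v).1 (hasd e he v hv)).1
  have h2 := hnull e he v hv
  have h3 := hnull e he e he
  rw [dotProduct_metric_mulVec] at h2 h3
  refine ⟨by linarith, mul_left_cancel₀ h0 ?_⟩
  linear_combination (e 0 ^ 2 + e 1 ^ 2) * h2 - (e 0 * v 0 + e 1 * v 1) / 2 * h3 +
    (e 1 * e 2 - e 0 * e 3) * h1

theorem isBetaPlane_of_relations {f : ℝ × ℝ → ℝ} {x : R4} {P : Submodule ℝ R4}
    (hdim : Module.finrank ℝ P = 2) {c s : ℝ}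
    (h : ∀ v ∈ P, ∃ a b : ℝ, v = ![c * a, s * a, -c * (f (x 0, x 1) / 2 * a) - s * b,
      -s * (f (x 0, x 1) / 2 * a) + c * b]) : IsBetaPlane (metric f x) P := by
  refine ⟨hdim, fun v hv w hw => ?_, fun v hv w hw => ?_⟩
  · obtain ⟨a, b, rfl⟩ := h v hv
    obtain ⟨a', b', rfl⟩ := h w hw
    rw [dotProduct_metric_mulVec]
    simp
    ring
  · obtain ⟨a, b, rfl⟩ := h v hv
    obtain ⟨a', b', rfl⟩ := h w hw
    rw [hodgeStar_wedge]
    simp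
    exact ⟨by ring, by ring, by ring⟩

/-! ### Calculus tools: vanishing one-forms, the primitive `φ`, tangent vectors. -/

/-- If the one-form `∑ αᵢ dψᵢ` vanishes near `u`, then so does its exterior derivative
`∑ dαᵢ ∧ dψᵢ` at `u`. -/
theorem sum_fderiv_symm {E : Type*} [NormedAddCommGroup E] [NormedSpace ℝ E] {ψ : E → R4} {u : E}
    (hψ : ContDiffAt ℝ 2 ψ u) {α : Fin 4 → E → ℝ} {α' : Fin 4 → E →L[ℝ] ℝ}
    (hα : ∀ i, HasFDerivAt (α i) (α' i) u)
    (h0 : ∀ᶠ y in 𝓝 u, ∀ w, ∑ i, α i y * fderiv ℝ ψ y w i = 0) (v w : E) :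
    ∑ i, α' i v * fderiv ℝ ψ u w i = ∑ i, α' i w * fderiv ℝ ψ u v i := by
  have hd : HasFDerivAt (fderiv ℝ ψ) (fderiv ℝ (fderiv ℝ ψ) u) u :=
    ((hψ.fderiv_right (m := 1) (by norm_num)).differentiableAt (by norm_num)).hasFDerivAt
  have hsymm : IsSymmSndFDerivAt ℝ ψ u := hψ.isSymmSndFDerivAt (by simp)
  -- Differentiating the vanishing form leaves a second-derivative term, symmetric in `v` and `w`.
  have key : ∀ v w, ∑ i, α' i v * fderiv ℝ ψ u w i =
      -∑ i, α i u * fderiv ℝ (fderiv ℝ ψ) u v w i := by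
    intro v w
    have h1 : ∀ i, HasFDerivAt (fun y => fderiv ℝ ψ y w i)
        ((ContinuousLinearMap.proj i).comp ((ContinuousLinearMap.apply ℝ R4 w).comp
          (fderiv ℝ (fderiv ℝ ψ) u))) u := fun i =>
      (ContinuousLinearMap.proj (R := ℝ) (φ := fun _ : Fin 4 => ℝ) i).hasFDerivAt.comp u
        ((ContinuousLinearMap.apply ℝ R4 w).hasFDerivAt.comp u hd)
    have h2 := HasFDerivAt.fun_sum (u := Finset.univ) fun i _ => (hα i).fun_mul (h1 i)
    have h3 : HasFDerivAt (fun y => ∑ i, α i y * fderiv ℝ ψ y w i) (0 : E →L[ℝ] ℝ) u :=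
      (hasFDerivAt_const (0 : ℝ) u).congr_of_eventuallyEq (h0.mono fun y hy => hy w)
    have h4 := congrArg (fun L : E →L[ℝ] ℝ => L v) (h2.unique h3)
    simp only [sum_apply, add_apply,
      smul_apply, ContinuousLinearMap.comp_apply, smul_eq_mul,
      ContinuousLinearMap.proj_apply, ContinuousLinearMap.apply_apply,
      zero_apply, Finset.sum_add_distrib] at h4
    rw [← eq_neg_iff_add_eq_zero] at h4
    rw [h4, neg_neg]
    exact Finset.sum_congr rfl fun i _ => mul_comm _ _
  rw [key, key]
  simp only [hsymm v w]

/-- The integral `φ` in the rotated coordinates `l = cos σ x₁ + sin σ x₂`,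
`m = -sin σ x₁ + cos σ x₂`. -/
noncomputable def phiRot (f : ℝ × ℝ → ℝ) (σ m l : ℝ) : ℝ :=
  (1 / 2) * ∫ t in (0 : ℝ)..l,
    f (Real.cos σ * t - Real.sin σ * m, Real.sin σ * t + Real.cos σ * m)

theorem phi_eq_phiRot (f : ℝ × ℝ → ℝ) (x₁ x₂ σ : ℝ) :
    phi f x₁ x₂ σ = phiRot f σ (-Real.sin σ * x₁ + Real.cos σ * x₂)
      (Real.cos σ * x₁ + Real.sin σ * x₂) := rfl

theorem hasDerivAt_phiRot {f : ℝ × ℝ → ℝ} (hf : Continuous f) (σ m l : ℝ) :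
    HasDerivAt (phiRot f σ m)
      (f (Real.cos σ * l - Real.sin σ * m, Real.sin σ * l + Real.cos σ * m) / 2) l := by
  have hc : Continuous fun t : ℝ =>
      f (Real.cos σ * t - Real.sin σ * m, Real.sin σ * t + Real.cos σ * m) := by fun_prop
  have := (intervalIntegral.integral_hasDerivAt_right (hc.intervalIntegrable 0 l)
    hc.aestronglyMeasurable.stronglyMeasurableAtFilter hc.continuousAt).const_mul (1 / 2 : ℝ)
  exact this.congr_deriv (by ring)

theorem contDiff_phiRot {f : ℝ × ℝ → ℝ} (hf : ContDiff ℝ ∞ f) (σ m : ℝ) :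
    ContDiff ℝ ∞ (phiRot f σ m) := by
  rw [contDiff_infty_iff_deriv]
  refine ⟨fun l => (hasDerivAt_phiRot hf.continuous σ m l).differentiableAt, ?_⟩
  rw [show deriv (phiRot f σ m) = _ from funext fun l => (hasDerivAt_phiRot hf.continuous σ m l).deriv]
  fun_prop

/-- Derivatives of points of `V` along a parametrization are tangent to the surface. -/
theorem fderiv_mem_tangentPlane {S : Set R4} {V : Set (Fin 2 → ℝ)} {ψ : (Fin 2 → ℝ) → R4}
    (hV : IsOpen V) (hψ : ContDiffOn ℝ ∞ ψ V) (hS : ψ '' V ⊆ S) {u : Fin 2 → ℝ} (hu : u ∈ V)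
    (w : Fin 2 → ℝ) : fderiv ℝ ψ u w ∈ tangentPlane S (ψ u) := by
  have hψu : ContDiffAt ℝ ∞ ψ u := hψ.contDiffAt (hV.mem_nhds hu)
  have hline : ContDiff ℝ ∞ fun t : ℝ => u + t • w := by fun_prop
  have hd : HasDerivAt (fun t : ℝ => u + t • w) w 0 := by
    simpa using ((hasDerivAt_id (0 : ℝ)).smul_const w).const_add u
  have h0 : u + (0 : ℝ) • w = u := by simp
  refine Submodule.subset_span ⟨fun t => ψ (u + t • w), ?_, by simp, ?_, ?_⟩
  · exact ContDiffAt.comp (0 : ℝ) (g := ψ) (by rwa [h0]) hline.contDiffAt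
  · have : ∀ᶠ t in 𝓝 (0 : ℝ), u + t • w ∈ V :=
      hline.continuous.continuousAt.eventually_mem (by rw [h0]; exact hV.mem_nhds hu)
    exact this.mono fun t ht => hS ⟨_, ht, rfl⟩
  · have h1 : HasFDerivAt ψ (fderiv ℝ ψ u) (u + (0 : ℝ) • w) := by
      rw [h0]; exact (hψu.differentiableAt (by simp)).hasFDerivAt
    exact (h1.comp_hasDerivAt (0 : ℝ) hd).deriv

/-! ### Rigidity of surfaces tangent to `β`-planes. -/

/-- Closed one-form argument: with `L = dψ₁(e)`, `M = dψ₂(e)`, the direction `[L : M]` of the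
projection of a `β`-surface to the `(x₁, x₂)`-plane has vanishing derivative. -/
theorem direction_fderiv_eq_zero {f : ℝ × ℝ → ℝ} (hf : ContDiff ℝ ∞ f)
    {ψ : (Fin 2 → ℝ) → R4} {u e : Fin 2 → ℝ} (hψ : ContDiffAt ℝ ∞ ψ u)
    (hinj : Function.Injective (fderiv ℝ ψ u))
    (he : fderiv ℝ ψ u e 0 ^ 2 + fderiv ℝ ψ u e 1 ^ 2 ≠ 0)
    (hrel : ∀ᶠ y in 𝓝 u, ∀ w,
      -fderiv ℝ ψ y e 1 * fderiv ℝ ψ y w 0 + fderiv ℝ ψ y e 0 * fderiv ℝ ψ y w 1 = 0 ∧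
      f (ψ y 0, ψ y 1) / 2 *
          (fderiv ℝ ψ y e 0 * fderiv ℝ ψ y w 0 + fderiv ℝ ψ y e 1 * fderiv ℝ ψ y w 1) +
        fderiv ℝ ψ y e 0 * fderiv ℝ ψ y w 2 + fderiv ℝ ψ y e 1 * fderiv ℝ ψ y w 3 = 0)
    {L' M' : (Fin 2 → ℝ) →L[ℝ] ℝ} (hL : HasFDerivAt (fun y => fderiv ℝ ψ y e 0) L' u)
    (hM : HasFDerivAt (fun y => fderiv ℝ ψ y e 1) M' u) (v : Fin 2 → ℝ) :
    fderiv ℝ ψ u e 0 * M' v - fderiv ℝ ψ u e 1 * L' v = 0 := by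
  have hψ2 : ContDiffAt ℝ 2 ψ u := hψ.of_le (WithTop.coe_le_coe.2 le_top)
  have hψd : HasFDerivAt ψ (fderiv ℝ ψ u) u := (hψ.differentiableAt (by simp)).hasFDerivAt
  have hfu : HasFDerivAt f (fderiv ℝ f (ψ u 0, ψ u 1)) (ψ u 0, ψ u 1) :=
    (hf.differentiable (by simp) _).hasFDerivAt
  have hpsi := hasFDerivAt_pi'.1 hψd
  have hfψ := hfu.comp u ((hpsi 0).prodMk (hpsi 1))
  have hhalf := hfψ.const_mul (1 / 2 : ℝ)
  have e1 := sum_fderiv_symm hψ2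
    (α := ![fun y => -fderiv ℝ ψ y e 1, fun y => fderiv ℝ ψ y e 0, fun _ => 0, fun _ => 0])
    (α' := ![-M', L', 0, 0])
    (by
      intro i
      fin_cases i
      exacts [hM.neg, hL, hasFDerivAt_const _ _, hasFDerivAt_const _ _])
    (hrel.mono fun y hy w => by
      simpa [Fin.sum_univ_four] using (hy w).1)
  -- The blanks are the coefficients `(f/2) L`, `(f/2) M` and their derivatives, read off from
  -- `hhalf.mul hL` and `hhalf.mul hM`.
  have e2 := sum_fderiv_symm hψ2
    (α := ![_, _, fun y => fderiv ℝ ψ y e 0, fun y => fderiv ℝ ψ y e 1])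
    (α' := ![_, _, L', M'])
    (by
      intro i
      fin_cases i
      exacts [hhalf.mul hL, hhalf.mul hM, hL, hM])
    (hrel.mono fun y hy w => by
      simp [Fin.sum_univ_four]
      linear_combination (hy w).2)
  simp [Fin.sum_univ_four] at e1 e2
  have hr := hrel.self_of_nhds
  generalize hl : fderiv ℝ ψ u e 0 = l at *
  generalize hm : fderiv ℝ ψ u e 1 = m at *
  -- By the first relation `(dψ₁, dψ₂) = (l, m) θ`; below, `hρθ` and `hρη` say `ρ ∧ θ = 0` and `ρ ∧
  -- η = 0` with `η = -m dψ₃ + l dψ₄`.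
  obtain ⟨θ, hθ⟩ : ∃ θ : (Fin 2 → ℝ) → ℝ, ∀ w,
      fderiv ℝ ψ u w 0 = l * θ w ∧ fderiv ℝ ψ u w 1 = m * θ w := by
    refine ⟨fun w => (l * fderiv ℝ ψ u w 0 + m * fderiv ℝ ψ u w 1) / (l ^ 2 + m ^ 2),
      fun w => ⟨?_, ?_⟩⟩
    · field_simp
      linear_combination -m * (hr w).1
    · field_simp
      linear_combination l * (hr w).1
  have hfθ : ∀ w, fderiv ℝ f (ψ u 0, ψ u 1) (l * θ w, m * θ w) =
      θ w * fderiv ℝ f (ψ u 0, ψ u 1) (l, m) := fun w => by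
    rw [← smul_eq_mul (θ w), ← map_smul]
    simp [mul_comm]
  have hρθ : ∀ v w, (l * M' v - m * L' v) * θ w = (l * M' w - m * L' w) * θ v := fun v w => by
    have := e1 v w
    simp only [hθ] at this
    linear_combination -this
  have hρη : ∀ v w,
      (l * M' v - m * L' v) * (-m * fderiv ℝ ψ u w 2 + l * fderiv ℝ ψ u w 3) =
      (l * M' w - m * L' w) * (-m * fderiv ℝ ψ u v 2 + l * fderiv ℝ ψ u v 3) := fun v w => by
    have h1 := e2 v w
    have hv := (hr v).2
    have hw := (hr w).2
    simp only [hθ, hfθ] at h1 hv hw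
    linear_combination (l ^ 2 + m ^ 2) * h1 - (l * L' v + m * M' v) * hw +
      (l * L' w + m * M' w) * hv
  -- If `ρ w = 0` but `ρ v ≠ 0`, then `θ w = η w = 0`, and the second relation forces `dψ w = 0`,
  -- against injectivity.
  have hker : ∀ w, l * M' w - m * L' w = 0 → w ≠ 0 → l * M' v - m * L' v = 0 := by
    intro w hw hw0
    by_contra hne
    have h1 : θ w = 0 := by simpa [hw, hne] using hρθ v w
    have h2 : -m * fderiv ℝ ψ u w 2 + l * fderiv ℝ ψ u w 3 = 0 := by
      simpa [hw, hne] using hρη v w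
    have h3 := (hr w).2
    have h4 := hθ w
    rw [h1, mul_zero, mul_zero] at h4
    rw [h4.1, h4.2] at h3
    have h5 : fderiv ℝ ψ u w 2 = 0 := mul_left_cancel₀ he (by linear_combination l * h3 - m * h2)
    have h6 : fderiv ℝ ψ u w 3 = 0 := mul_left_cancel₀ he (by linear_combination m * h3 + l * h2)
    refine hw0 (hinj ?_)
    rw [map_zero]
    ext i
    fin_cases i
    exacts [h4.1, h4.2, h5, h6]
  set a := l * M' ![1, 0] - m * L' ![1, 0] with ha
  set b := l * M' ![0, 1] - m * L' ![0, 1] with hb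
  have hlin : ∀ w : Fin 2 → ℝ, l * M' w - m * L' w = w 0 * a + w 1 * b := fun w => by
    have : w = w 0 • ![1, 0] + w 1 • ![0, 1] := by ext i; fin_cases i <;> simp
    rw [this, map_add, map_add, map_smul, map_smul, map_smul, map_smul, ha, hb]
    simp
    ring
  by_cases hab : a = 0 ∧ b = 0
  · rw [hlin, hab.1, hab.2]; ring
  -- In two dimensions the functional `ρ = (a, b)` always kills `(b, -a)`.
  · refine hker ![b, -a] (by rw [hlin]; simp; ring) fun h => hab ⟨?_, ?_⟩
    · simpa using congrFun h 1
    · simpa using congrFun h 0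

/-- A `β`-surface is locally contained in one of the model surfaces. -/
theorem local_constancy {f : ℝ × ℝ → ℝ} (hf : ContDiff ℝ ∞ f) {S : Set R4}
    (hβ : ∀ p ∈ S, IsBetaPlane (metric f p) (tangentPlane S p))
    {W : Set (Fin 2 → ℝ)} {ψ : (Fin 2 → ℝ) → R4} (hW : IsOpen W) (hWc : Convex ℝ W)
    (hψ : ContDiffOn ℝ ∞ ψ W) (hS : ψ '' W ⊆ S)
    (hinj : ∀ u ∈ W, Function.Injective (fderiv ℝ ψ u)) {e : Fin 2 → ℝ}
    (he : ∀ u ∈ W, fderiv ℝ ψ u e 0 ^ 2 + fderiv ℝ ψ u e 1 ^ 2 ≠ 0) {u u' : Fin 2 → ℝ}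
    (hu : u ∈ W) (hu' : u' ∈ W) (σ : ℝ)
    (hσ : ∀ v ∈ tangentPlane S (ψ u), -Real.sin σ * v 0 + Real.cos σ * v 1 = 0) :
    (∀ v ∈ tangentPlane S (ψ u'), -Real.sin σ * v 0 + Real.cos σ * v 1 = 0) ∧
    -Real.sin σ * ψ u 0 + Real.cos σ * ψ u 1 = -Real.sin σ * ψ u' 0 + Real.cos σ * ψ u' 1 ∧
    Real.cos σ * ψ u 2 + Real.sin σ * ψ u 3 + phi f (ψ u 0) (ψ u 1) σ =
      Real.cos σ * ψ u' 2 + Real.sin σ * ψ u' 3 + phi f (ψ u' 0) (ψ u' 1) σ := by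
  have hcs := Real.sin_sq_add_cos_sq σ
  have hmem : ∀ y ∈ W, ∀ w, fderiv ℝ ψ y w ∈ tangentPlane S (ψ y) := fun y hy w =>
    fderiv_mem_tangentPlane hW hψ hS hy w
  have hat : ∀ y ∈ W, ContDiffAt ℝ ∞ ψ y := fun y hy => hψ.contDiffAt (hW.mem_nhds hy)
  have hd1 : ∀ y ∈ W, ∀ i, HasFDerivAt (fun z => fderiv ℝ ψ z e i)
      (fderiv ℝ (fun z => fderiv ℝ ψ z e i) y) y := fun y hy i => by
    have h1 : ContDiffAt ℝ ∞ (fderiv ℝ ψ) y := (hat y hy).fderiv_right (by simp)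
    have h2 : DifferentiableAt ℝ (fun z => fderiv ℝ ψ z e) y :=
      (h1.differentiableAt (by simp)).clm_apply (differentiableAt_const e)
    exact (differentiableAt_pi.1 h2 i).hasFDerivAt
  have hrel : ∀ y ∈ W, ∀ v ∈ tangentPlane S (ψ y), _ := fun y hy v hv =>
    (hβ _ (hS ⟨y, hy, rfl⟩)).relations (hmem y hy e) hv (he y hy)
  have hρ : ∀ y ∈ W, ∀ w, fderiv ℝ ψ y e 0 * fderiv ℝ (fun z => fderiv ℝ ψ z e 1) y w -
      fderiv ℝ ψ y e 1 * fderiv ℝ (fun z => fderiv ℝ ψ z e 0) y w = 0 := fun y hy w =>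
    direction_fderiv_eq_zero hf (hat y hy) (hinj y hy) (he y hy)
      ((hW.eventually_mem hy).mono fun z hz w => hrel z hz _ (hmem z hz w))
      (hd1 y hy 0) (hd1 y hy 1) w
  have hzero : ∀ y ∈ W, -Real.sin σ * fderiv ℝ ψ y e 0 + Real.cos σ * fderiv ℝ ψ y e 1 = 0 := by
    intro y hy
    -- The squared sine of the angle between the projected direction and `σ`: it needs no branch of
    -- the angle, its derivative is a multiple of `ρ`, and it vanishes at `u`.
    have hg : ∀ z ∈ W, HasFDerivAt (fun z =>
        (-Real.sin σ * fderiv ℝ ψ z e 0 + Real.cos σ * fderiv ℝ ψ z e 1) ^ 2 /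
        (fderiv ℝ ψ z e 0 ^ 2 + fderiv ℝ ψ z e 1 ^ 2)) (0 : (Fin 2 → ℝ) →L[ℝ] ℝ) z := by
      intro z hz
      have h0 := hd1 z hz 0
      have h1 := hd1 z hz 1
      have h2 := HasFDerivAt.pow ((h0.const_mul (-Real.sin σ)).fun_add (h1.const_mul (Real.cos σ))) 2
      have h3 := (hasDerivAt_inv (he z hz)).comp_hasFDerivAt z
        ((HasFDerivAt.pow h0 2).fun_add (HasFDerivAt.pow h1 2))
      have h4 := h2.fun_mul h3
      simp only [div_eq_mul_inv]
      refine h4.congr_fderiv ?_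
      ext w
      have hz' := he z hz
      have hw := hρ z hz w
      simp
      field_simp
      linear_combination 2 * (-Real.sin σ * fderiv ℝ ψ z e 0 + Real.cos σ * fderiv ℝ ψ z e 1) *
        (Real.cos σ * fderiv ℝ ψ z e 0 + Real.sin σ * fderiv ℝ ψ z e 1) * hw
    have hc := hW.is_const_of_fderiv_eq_zero (𝕜 := ℝ) hWc.isPreconnected
      (fun z hz => (hg z hz).differentiableAt.differentiableWithinAt)
      (fun z hz => (hg z hz).fderiv) hy hu
    rw [hσ _ (hmem u hu e)] at hc
    simpa [he y hy] using hc
  have hdir : ∀ y ∈ W, ∃ k : ℝ, k ≠ 0 ∧ fderiv ℝ ψ y e 0 = Real.cos σ * k ∧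
      fderiv ℝ ψ y e 1 = Real.sin σ * k := by
    intro y hy
    have h0 := hzero y hy
    refine ⟨Real.cos σ * fderiv ℝ ψ y e 0 + Real.sin σ * fderiv ℝ ψ y e 1, fun hk => ?_, ?_, ?_⟩
    · refine he y hy ?_
      linear_combination -(fderiv ℝ ψ y e 0 ^ 2 + fderiv ℝ ψ y e 1 ^ 2) * hcs +
        (Real.cos σ * fderiv ℝ ψ y e 0 + Real.sin σ * fderiv ℝ ψ y e 1) * hk +
        (-Real.sin σ * fderiv ℝ ψ y e 0 + Real.cos σ * fderiv ℝ ψ y e 1) * h0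
    · linear_combination -fderiv ℝ ψ y e 0 * hcs - Real.sin σ * h0
    · linear_combination -fderiv ℝ ψ y e 1 * hcs + Real.cos σ * h0
  have htan : ∀ y ∈ W, ∀ v ∈ tangentPlane S (ψ y),
      -Real.sin σ * v 0 + Real.cos σ * v 1 = 0 ∧
      f (ψ y 0, ψ y 1) / 2 * (Real.cos σ * v 0 + Real.sin σ * v 1) +
        Real.cos σ * v 2 + Real.sin σ * v 3 = 0 := by
    intro y hy v hv
    obtain ⟨k, hk, h0, h1⟩ := hdir y hy
    have := hrel y hy v hv
    rw [h0, h1] at this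
    exact ⟨mul_left_cancel₀ hk (by linear_combination this.1),
      mul_left_cancel₀ hk (by linear_combination this.2)⟩
  have hcomp : ∀ y ∈ W, ∀ i, HasFDerivAt (fun z => ψ z i)
      ((ContinuousLinearMap.proj i).comp (fderiv ℝ ψ y)) y := fun y hy =>
    hasFDerivAt_pi'.1 ((hat y hy).differentiableAt (by simp)).hasFDerivAt
  have hconst : ∀ F : (Fin 2 → ℝ) → ℝ,
      (∀ y ∈ W, HasFDerivAt F (0 : (Fin 2 → ℝ) →L[ℝ] ℝ) y) → ∀ y ∈ W, ∀ z ∈ W, F y = F z :=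
    fun F hF y hy z hz => hW.is_const_of_fderiv_eq_zero (𝕜 := ℝ) hWc.isPreconnected
      (fun z hz => (hF z hz).differentiableAt.differentiableWithinAt)
      (fun z hz => (hF z hz).fderiv) hy hz
  have hμ := hconst (fun z => -Real.sin σ * ψ z 0 + Real.cos σ * ψ z 1) (by
    intro y hy
    refine (((hcomp y hy 0).const_mul (-Real.sin σ)).add
      ((hcomp y hy 1).const_mul (Real.cos σ))).congr_fderiv ?_
    ext w
    simpa using (htan y hy _ (hmem y hy w)).1)
  refine ⟨fun v hv => (htan u' hu' v hv).1, hμ u hu u' hu', ?_⟩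
  -- Since `μ` is constant by `hμ`, it is frozen at its value at `u`; no differentiation under the
  -- integral sign is needed.
  have hF := hconst (fun z => Real.cos σ * ψ z 2 + Real.sin σ * ψ z 3 +
      phiRot f σ (-Real.sin σ * ψ u 0 + Real.cos σ * ψ u 1)
        (Real.cos σ * ψ z 0 + Real.sin σ * ψ z 1)) (by
    intro y hy
    have h := hasDerivAt_phiRot hf.continuous σ (-Real.sin σ * ψ u 0 + Real.cos σ * ψ u 1)
      (Real.cos σ * ψ y 0 + Real.sin σ * ψ y 1)
    have h1 := h.comp_hasFDerivAt y
      (((hcomp y hy 0).const_mul (Real.cos σ)).add ((hcomp y hy 1).const_mul (Real.sin σ)))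
    refine ((((hcomp y hy 2).const_mul (Real.cos σ)).add
      ((hcomp y hy 3).const_mul (Real.sin σ))).add h1).congr_fderiv ?_
    have hm : -Real.sin σ * ψ u 0 + Real.cos σ * ψ u 1 =
      -Real.sin σ * ψ y 0 + Real.cos σ * ψ y 1 := hμ u hu y hy
    rw [hm, show Real.cos σ * (Real.cos σ * ψ y 0 + Real.sin σ * ψ y 1) -
        Real.sin σ * (-Real.sin σ * ψ y 0 + Real.cos σ * ψ y 1) = ψ y 0 by
          linear_combination ψ y 0 * hcs,
      show Real.sin σ * (Real.cos σ * ψ y 0 + Real.sin σ * ψ y 1) +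
        Real.cos σ * (-Real.sin σ * ψ y 0 + Real.cos σ * ψ y 1) = ψ y 1 by
          linear_combination ψ y 1 * hcs]
    ext w
    simp
    linear_combination (htan y hy _ (hmem y hy w)).2) u hu u' hu'
  have hm : -Real.sin σ * ψ u 0 + Real.cos σ * ψ u 1 =
    -Real.sin σ * ψ u' 0 + Real.cos σ * ψ u' 1 := hμ u hu u' hu'
  rw [phi_eq_phiRot, phi_eq_phiRot, ← hm]
  exact hF

/-! ### The model surfaces. -/

/-- A global parametrization of the surface `x₂ cos σ - x₁ sin σ = c₁`,
`x₃ cos σ + x₄ sin σ + φ = c₂`. -/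
noncomputable def modelParam (f : ℝ × ℝ → ℝ) (σ c₁ c₂ : ℝ) (u : Fin 2 → ℝ) : R4 :=
  ![Real.cos σ * u 0 - Real.sin σ * c₁, Real.sin σ * u 0 + Real.cos σ * c₁,
    Real.cos σ * (c₂ - phiRot f σ c₁ (u 0)) - Real.sin σ * u 1,
    Real.sin σ * (c₂ - phiRot f σ c₁ (u 0)) + Real.cos σ * u 1]

/-- The linear left inverse of `modelParam`. -/
noncomputable def modelCoord (σ : ℝ) : R4 →L[ℝ] (Fin 2 → ℝ) :=
  ContinuousLinearMap.pi
    ![Real.cos σ • ContinuousLinearMap.proj 0 + Real.sin σ • ContinuousLinearMap.proj 1,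
      -Real.sin σ • ContinuousLinearMap.proj 2 + Real.cos σ • ContinuousLinearMap.proj 3]

theorem modelCoord_modelParam (f : ℝ × ℝ → ℝ) (σ c₁ c₂ : ℝ) (u : Fin 2 → ℝ) :
    modelCoord σ (modelParam f σ c₁ c₂ u) = u := by
  have hcs := Real.sin_sq_add_cos_sq σ
  ext i
  fin_cases i
  · simp [modelCoord, modelParam]
    linear_combination u 0 * hcs
  · simp [modelCoord, modelParam]
    linear_combination u 1 * hcs

/-- The surface `x₂ cos σ - x₁ sin σ = c₁`, `x₃ cos σ + x₄ sin σ + φ = c₂`. -/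
def modelSurface (f : ℝ × ℝ → ℝ) (σ c₁ c₂ : ℝ) : Set R4 :=
  {x | -Real.sin σ * x 0 + Real.cos σ * x 1 = c₁ ∧
    Real.cos σ * x 2 + Real.sin σ * x 3 + phi f (x 0) (x 1) σ = c₂}

theorem modelParam_modelCoord {f : ℝ × ℝ → ℝ} {σ c₁ c₂ : ℝ} {x : R4}
    (hx : x ∈ modelSurface f σ c₁ c₂) : modelParam f σ c₁ c₂ (modelCoord σ x) = x := by
  have hcs := Real.sin_sq_add_cos_sq σ
  obtain ⟨h1, h2⟩ := hx
  rw [phi_eq_phiRot, h1] at h2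
  ext i
  fin_cases i <;> simp [modelCoord, modelParam]
  · linear_combination x 0 * hcs + Real.sin σ * h1
  · linear_combination x 1 * hcs - Real.cos σ * h1
  · linear_combination x 2 * hcs - Real.cos σ * h2
  · linear_combination x 3 * hcs - Real.sin σ * h2

theorem modelParam_mem (f : ℝ × ℝ → ℝ) (σ c₁ c₂ : ℝ) (u : Fin 2 → ℝ) :
    modelParam f σ c₁ c₂ u ∈ modelSurface f σ c₁ c₂ := by
  have hcs := Real.sin_sq_add_cos_sq σ
  have h1 : -Real.sin σ * modelParam f σ c₁ c₂ u 0 + Real.cos σ * modelParam f σ c₁ c₂ u 1 = c₁ := by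
    simp [modelParam]
    linear_combination c₁ * hcs
  have h2 : Real.cos σ * modelParam f σ c₁ c₂ u 0 + Real.sin σ * modelParam f σ c₁ c₂ u 1 = u 0 := by
    simp [modelParam]
    linear_combination u 0 * hcs
  refine ⟨h1, ?_⟩
  rw [phi_eq_phiRot, h1, h2]
  simp [modelParam]
  linear_combination (c₂ - phiRot f σ c₁ (u 0)) * hcs

theorem image_modelParam (f : ℝ × ℝ → ℝ) (σ c₁ c₂ : ℝ) :
    modelParam f σ c₁ c₂ '' Set.univ = modelSurface f σ c₁ c₂ := by
  ext x
  constructor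
  · rintro ⟨u, -, rfl⟩
    exact modelParam_mem f σ c₁ c₂ u
  · exact fun hx => ⟨_, trivial, modelParam_modelCoord hx⟩

theorem contDiff_modelParam {f : ℝ × ℝ → ℝ} (hf : ContDiff ℝ ∞ f) (σ c₁ c₂ : ℝ) :
    ContDiff ℝ ∞ (modelParam f σ c₁ c₂) := by
  have h : ContDiff ℝ ∞ fun u : Fin 2 → ℝ => phiRot f σ c₁ (u 0) :=
    (contDiff_phiRot hf σ c₁).comp (contDiff_apply ℝ ℝ 0)
  rw [contDiff_pi]
  intro i
  fin_cases i <;> simp [modelParam] <;> fun_prop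

theorem modelCoord_fderiv {f : ℝ × ℝ → ℝ} (hf : ContDiff ℝ ∞ f) (σ c₁ c₂ : ℝ)
    (u v : Fin 2 → ℝ) : modelCoord σ (fderiv ℝ (modelParam f σ c₁ c₂) u v) = v := by
  have h1 := (modelCoord σ).hasFDerivAt.comp u
    ((contDiff_modelParam hf σ c₁ c₂).differentiable (by simp) u).hasFDerivAt
  have h2 : HasFDerivAt (modelCoord σ ∘ modelParam f σ c₁ c₂)
      (ContinuousLinearMap.id ℝ (Fin 2 → ℝ)) u := by
    rw [show modelCoord σ ∘ modelParam f σ c₁ c₂ = id from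
      funext (modelCoord_modelParam f σ c₁ c₂)]
    exact hasFDerivAt_id u
  exact congrArg (fun L : (Fin 2 → ℝ) →L[ℝ] (Fin 2 → ℝ) => L v) (h1.unique h2)

theorem fderiv_modelParam {f : ℝ × ℝ → ℝ} (hf : ContDiff ℝ ∞ f) (σ c₁ c₂ : ℝ)
    (u v : Fin 2 → ℝ) : fderiv ℝ (modelParam f σ c₁ c₂) u v =
      ![Real.cos σ * v 0, Real.sin σ * v 0,
        -Real.cos σ * (f (modelParam f σ c₁ c₂ u 0, modelParam f σ c₁ c₂ u 1) / 2 * v 0) -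
          Real.sin σ * v 1,
        -Real.sin σ * (f (modelParam f σ c₁ c₂ u 0, modelParam f σ c₁ c₂ u 1) / 2 * v 0) +
          Real.cos σ * v 1] := by
  have hd := ((contDiff_modelParam hf σ c₁ c₂).differentiable (by simp) u).hasFDerivAt
  have hp := hasFDerivAt_pi'.1 hd
  have h0 : HasFDerivAt (fun u : Fin 2 → ℝ => u 0) (ContinuousLinearMap.proj (R := ℝ) 0) u :=
    hasFDerivAt_apply 0 u
  have h1 : HasFDerivAt (fun u : Fin 2 → ℝ => u 1) (ContinuousLinearMap.proj (R := ℝ) 1) u :=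
    hasFDerivAt_apply 1 u
  have hphi := ((hasDerivAt_phiRot hf.continuous σ c₁ (u 0)).comp_hasFDerivAt u h0).const_sub c₂
  have key : ∀ i (L : (Fin 2 → ℝ) →L[ℝ] ℝ),
      HasFDerivAt (fun y => modelParam f σ c₁ c₂ y i) L u →
      fderiv ℝ (modelParam f σ c₁ c₂) u v i = L v := fun i L hL =>
    congrArg (fun L : (Fin 2 → ℝ) →L[ℝ] ℝ => L v) ((hp i).unique hL)
  ext i
  fin_cases i
  · refine (key 0 _ ((h0.const_mul (Real.cos σ)).sub_const _)).trans ?_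
    simp
  · refine (key 1 _ ((h0.const_mul (Real.sin σ)).add_const _)).trans ?_
    simp
  · refine (key 2 _ ((hphi.const_mul (Real.cos σ)).sub (h1.const_mul (Real.sin σ)))).trans ?_
    simp [modelParam]
  · refine (key 3 _ ((hphi.const_mul (Real.sin σ)).add (h1.const_mul (Real.cos σ)))).trans ?_
    simp [modelParam]

/-- A curve `γ` in the surface equals `modelParam ∘ modelCoord ∘ γ` near `0`, so the chain rule puts
its velocity in the range. -/
theorem tangentPlane_modelSurface {f : ℝ × ℝ → ℝ} (hf : ContDiff ℝ ∞ f) (σ c₁ c₂ : ℝ)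
    (u : Fin 2 → ℝ) : tangentPlane (modelSurface f σ c₁ c₂) (modelParam f σ c₁ c₂ u) =
      (fderiv ℝ (modelParam f σ c₁ c₂) u).range := by
  apply le_antisymm
  · refine Submodule.span_le.2 ?_
    rintro v ⟨γ, hγ, h0, hmem, rfl⟩
    have hγd := (hγ.differentiableAt (by simp)).hasDerivAt
    have hu : modelCoord σ (γ 0) = u := by rw [h0, modelCoord_modelParam]
    have h1 : HasFDerivAt (modelParam f σ c₁ c₂) (fderiv ℝ (modelParam f σ c₁ c₂) u)
        ((modelCoord σ ∘ γ) 0) := by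
      rw [Function.comp_apply, hu]
      exact ((contDiff_modelParam hf σ c₁ c₂).differentiable (by simp) u).hasFDerivAt
    have h2 := h1.comp_hasDerivAt (0 : ℝ) ((modelCoord σ).hasFDerivAt.comp_hasDerivAt (0 : ℝ) hγd)
    have h3 := h2.congr_of_eventuallyEq
      (hmem.mono fun t ht => (modelParam_modelCoord ht).symm : γ =ᶠ[𝓝 0] _)
    exact ⟨_, (hγd.unique h3).symm⟩
  · rintro _ ⟨w, rfl⟩
    exact fderiv_mem_tangentPlane isOpen_univ (contDiff_modelParam hf σ c₁ c₂).contDiffOn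
      (image_modelParam f σ c₁ c₂).le (Set.mem_univ u) w

theorem modelSurface_isBeta {f : ℝ × ℝ → ℝ} (hf : ContDiff ℝ ∞ f) (σ c₁ c₂ : ℝ) :
    IsConnected (modelSurface f σ c₁ c₂) ∧ IsEmbeddedSurface (modelSurface f σ c₁ c₂) ∧
    ∀ p ∈ modelSurface f σ c₁ c₂,
      IsBetaPlane (metric f p) (tangentPlane (modelSurface f σ c₁ c₂) p) := by
  have hsm := contDiff_modelParam hf σ c₁ c₂
  have hinj : ∀ u, Function.Injective (fderiv ℝ (modelParam f σ c₁ c₂) u) := fun u =>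
    Function.LeftInverse.injective (g := modelCoord σ) (modelCoord_fderiv hf σ c₁ c₂ u)
  refine ⟨?_, fun p _ => ?_, fun p hp => ?_⟩
  · rw [← image_modelParam]
    exact isConnected_univ.image _ hsm.continuous.continuousOn
  · refine ⟨Set.univ, Set.univ, modelParam f σ c₁ c₂, isOpen_univ, trivial, isOpen_univ,
      hsm.contDiffOn, fun u _ => hinj u, ?_, ?_⟩
    · exact Function.LeftInverse.isEmbedding (f := fun x => ⟨modelCoord σ x, trivial⟩)
        (fun u => Subtype.ext (modelCoord_modelParam f σ c₁ c₂ u))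
        ((modelCoord σ).continuous.subtype_mk _) (hsm.continuous.comp continuous_subtype_val)
    · rw [image_modelParam, Set.inter_univ]
  · obtain ⟨u, rfl⟩ : ∃ u, modelParam f σ c₁ c₂ u = p := ⟨_, modelParam_modelCoord hp⟩
    rw [tangentPlane_modelSurface hf]
    refine isBetaPlane_of_relations (c := Real.cos σ) (s := Real.sin σ) ?_ ?_
    · rw [LinearMap.finrank_range_of_inj (hinj u)]
      simp
    · rintro _ ⟨w, rfl⟩
      exact ⟨w 0, w 1, fderiv_modelParam hf σ c₁ c₂ u w⟩

/-! ### From local to global. -/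

/-- A connected surface whose tangent planes are `β`-planes lies in one of the model surfaces. -/
theorem exists_subset_modelSurface {f : ℝ × ℝ → ℝ} (hf : ContDiff ℝ ∞ f) {S : Set R4}
    (hconn : IsConnected S) (hemb : IsEmbeddedSurface S)
    (hβ : ∀ p ∈ S, IsBetaPlane (metric f p) (tangentPlane S p)) :
    ∃ σ c₁ c₂ : ℝ, S ⊆ modelSurface f σ c₁ c₂ := by
  -- Quantifying over every `σ`, with an equivalence of the angle conditions, makes `P` symmetric
  -- and transitive, as propagation along a connected set requires.
  let P : R4 → R4 → Prop := fun x y => ∀ σ : ℝ,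
    ((∀ v ∈ tangentPlane S x, -Real.sin σ * v 0 + Real.cos σ * v 1 = 0) ↔
      (∀ v ∈ tangentPlane S y, -Real.sin σ * v 0 + Real.cos σ * v 1 = 0)) ∧
    ((∀ v ∈ tangentPlane S x, -Real.sin σ * v 0 + Real.cos σ * v 1 = 0) →
      -Real.sin σ * x 0 + Real.cos σ * x 1 = -Real.sin σ * y 0 + Real.cos σ * y 1 ∧
      Real.cos σ * x 2 + Real.sin σ * x 3 + phi f (x 0) (x 1) σ =
        Real.cos σ * y 2 + Real.sin σ * y 3 + phi f (y 0) (y 1) σ)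
  have hglob : ∀ {x y : R4}, x ∈ S → y ∈ S → P x y := by
    refine hconn.isPreconnected.induction₂ P ?_ ?_ ?_
    · intro p hp
      obtain ⟨U, V, ψ, hU, hpU, hV, hψ, hinj, hψe, himg⟩ := hemb p hp
      obtain ⟨u, hu, rfl⟩ : p ∈ ψ '' V := himg ▸ ⟨hp, hpU⟩
      have hVS : ψ '' V ⊆ S := himg.le.trans Set.inter_subset_left
      -- By dimension the range of `dψ` is the whole tangent plane, so a tangent vector with nonzero
      -- projection lifts to a parameter direction `e`, kept constant near `u`.
      obtain ⟨e, he⟩ : ∃ e, fderiv ℝ ψ u e 0 ^ 2 + fderiv ℝ ψ u e 1 ^ 2 ≠ 0 := by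
        obtain ⟨d, hd, hd0⟩ := (hβ _ hp).exists_ne_zero
        have hle : (fderiv ℝ ψ u).range ≤ tangentPlane S (ψ u) := by
          rintro _ ⟨w, rfl⟩
          exact fderiv_mem_tangentPlane hV hψ hVS hu w
        have heq := Submodule.eq_of_le_of_finrank_eq hle (by
          rw [LinearMap.finrank_range_of_inj (hinj u hu), (hβ _ hp).1]
          simp)
        rw [← heq] at hd
        obtain ⟨e, rfl⟩ := hd
        exact ⟨e, hd0⟩
      have hopen : ∀ᶠ y in 𝓝 u, y ∈ V ∧ fderiv ℝ ψ y e 0 ^ 2 + fderiv ℝ ψ y e 1 ^ 2 ≠ 0 := by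
        have hc : ContinuousAt (fderiv ℝ ψ) u :=
          ((hψ.contDiffAt (hV.mem_nhds hu)).fderiv_right (m := 0) (by simp)).continuousAt
        have hce : ContinuousAt (fun y => fderiv ℝ ψ y e) u := hc.clm_apply continuousAt_const
        have hci := continuousAt_pi.1 hce
        exact (hV.eventually_mem hu).and ((((hci 0).pow 2).add ((hci 1).pow 2)).eventually_ne he)
      obtain ⟨r, hr, hball⟩ := Metric.eventually_nhds_iff_ball.1 hopen
      have hWV : Metric.ball u r ⊆ V := fun y hy => (hball y hy).1
      have hloc := fun (y y' : Fin 2 → ℝ) (hy : y ∈ Metric.ball u r) (hy' : y' ∈ Metric.ball u r) =>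
        local_constancy hf hβ Metric.isOpen_ball (convex_ball u r) (hψ.mono hWV)
          ((Set.image_mono hWV).trans hVS) (fun y hy => hinj y (hWV hy))
          (fun y hy => (hball y hy).2) hy hy'
      -- The embedding property turns a ball in the parameters into a neighbourhood within `S`.
      have hmap := hψe.map_nhds_eq ⟨u, hu⟩
      rw [Set.range_domRestrict, himg] at hmap
      have hn : 𝓝[S] ψ u = 𝓝[S ∩ U] ψ u :=
        (nhdsWithin_inter_of_mem' (mem_nhdsWithin_of_mem_nhds (hU.mem_nhds hpU))).symm
      have hur : u ∈ Metric.ball u r := Metric.mem_ball_self hr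
      change ∀ᶠ y in 𝓝[S] ψ u, _
      rw [hn]
      change ∀ᶠ y in 𝓝[S ∩ U] (V.domRestrict ψ ⟨u, hu⟩), _
      rw [← hmap, Filter.eventually_map]
      have hev : ∀ᶠ y : V in 𝓝 ⟨u, hu⟩, (y : Fin 2 → ℝ) ∈ Metric.ball u r :=
        continuous_subtype_val.continuousAt.eventually_mem (Metric.ball_mem_nhds u hr)
      refine hev.mono fun y hy σ => ⟨⟨fun h => (hloc u y hur hy σ h).1,
        fun h => (hloc y u hy hur σ h).1⟩, fun h => (hloc u y hur hy σ h).2⟩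
    · intro x y z _ _ _ hxy hyz σ
      refine ⟨(hxy σ).1.trans (hyz σ).1, fun h => ?_⟩
      have h1 := (hxy σ).2 h
      have h2 := (hyz σ).2 ((hxy σ).1.1 h)
      exact ⟨h1.1.trans h2.1, h1.2.trans h2.2⟩
    · intro x y _ _ hxy σ
      refine ⟨(hxy σ).1.symm, fun h => ?_⟩
      have h1 := (hxy σ).2 ((hxy σ).1.2 h)
      exact ⟨h1.1.symm, h1.2.symm⟩
  obtain ⟨p, hp⟩ := hconn.nonempty
  obtain ⟨e, he, he0⟩ := (hβ p hp).exists_ne_zero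
  -- The angle `σ` is the argument of the projected direction at a base point.
  set z : ℂ := ⟨e 0, e 1⟩ with hz
  have hz0 : ‖z‖ ≠ 0 := by
    intro h
    rw [norm_eq_zero] at h
    exact he0 (by simp [show e 0 = 0 from congrArg Complex.re h,
      show e 1 = 0 from congrArg Complex.im h])
  have hc : ‖z‖ * Real.cos z.arg = e 0 := Complex.norm_mul_cos_arg z
  have hs : ‖z‖ * Real.sin z.arg = e 1 := Complex.norm_mul_sin_arg z
  refine ⟨z.arg, -Real.sin z.arg * p 0 + Real.cos z.arg * p 1,
    Real.cos z.arg * p 2 + Real.sin z.arg * p 3 + phi f (p 0) (p 1) z.arg, fun q hq => ?_⟩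
  have hA : ∀ v ∈ tangentPlane S p, -Real.sin z.arg * v 0 + Real.cos z.arg * v 1 = 0 := by
    intro v hv
    have := ((hβ p hp).relations he hv he0).1
    rw [← hc, ← hs] at this
    exact mul_left_cancel₀ hz0 (by linear_combination this)
  obtain ⟨h1, h2⟩ := (hglob hp hq z.arg).2 hA
  exact ⟨h1.symm, h2.symm⟩

end Petean

theorem mainTheorem6 (f : ℝ × ℝ → ℝ) (hf : ContDiff ℝ ∞ f) (S : Set Petean.R4)
    (hS : Petean.IsBetaSurface (Petean.metric f) S) :
    ∃ σ c₁ c₂ : ℝ, S = {x : Petean.R4 |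
      -Real.sin σ * x 0 + Real.cos σ * x 1 = c₁ ∧
      Real.cos σ * x 2 + Real.sin σ * x 3 + Petean.phi f (x 0) (x 1) σ = c₂} := by
  obtain ⟨⟨hconn, hemb, hβ⟩, hmax⟩ := hS
  obtain ⟨σ, c₁, c₂, hsub⟩ := Petean.exists_subset_modelSurface hf hconn hemb hβ
  exact ⟨σ, c₁, c₂, hsub.antisymm (hmax (Petean.modelSurface_isBeta hf σ c₁ c₂) hsub)⟩
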